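/- **Conventions.** A linear code of length $n$ over a finite field $\mathbb F$ is a subspace $\mathcal C\subseteq\mathbb F^n$; $\mathcal C|_S$ denotes its puncturing to the coordinates in $S$; an MDS code is one with minimum distance $d=n-k+1$, $k$ being its dimension. A *repair set* ($(r,\delta)$-locality) of a coordinate $j$ is a set $S\ni j$ of coordinates with $|S|\le r+\delta-1$ such that $\mathcal C|_S$ has minimum distance at least $\delta$; $\mathcal C$ has all-symbol $(r,\delta)$-locality if each coordinate has a repair set. An *$(n,r,h,\delta,Q)$-MR code* is a linear code of length $n$ over $\mathbb F_Q$ whose coordinates can be partitioned into repair sets $S_1,\dots,S_m$ of size $r+\delta-1$ each, $m=n/(r+\delta-1)$, such that the dimension is $mr-h$ and, for all $R_i\subseteq S_i$ with $|S_i\setminus R_i|=\delta-1$, the punctured code $\mathcal C|_{R_1\cup\dots\cup R_m}$ is MDS. **Construction.** Let $b,r,\delta\ge 2$ be integers, $q$ a prime power, $n=q^b-1$, $\alpha\in\mathbb F_{q^b}$ a primitive element, $a=r+\delta-1$ a divisor of $q-1$, and $m=n/a$ with $\gcd(\delta,m)=1$. Let $\mathcal C$ be the cyclic code of length $n$ over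 $\mathbb F_{q^b}$ with root set $$R=\{\alpha^{ja+t}: 1\le j\le m,\ 1\le t\le \delta-1\}\cup\{1,\alpha^\delta\},$$ i.e. with generator polynomial $\prod_{\rho\in R}(x-\rho)$. **Corollary.** The code $\mathcal C$ is a cyclic $(q^b-1,r,2,\delta,q^b)$-MR code, and the following hold. 1. If $r=2$ and neither $q^b-1$ nor $q^b-2$ is a prime power, then $\mathcal C$ has optimal field size: every $(q^b-1,2,2,\delta,Q)$-MR code satisfies $Q\ge q^b$. 2. If $r>2$, then $\mathcal C$ has optimal Hamming distance: $\mathcal C$ has all-symbol $(r,\delta)$-locality and, with $k=\dim\mathcal C$, its minimum distance attains the Singleton-type bound, $d=n-k+1-\left(\lceil k/r\rceil-1\right)(\delta-1)$. 3. If $r>2$, then $\mathcal C$ has order-optimal field size with respect to the lower bound $Q=\Omega\!\left(nr^{\min\{\delta-1,h-2\}}\right)$ for $(n,r,h,\delta,Q)$-MR codes with $n/(r+\delta-1)\ge h$, taken at $h=2$, where $\delta$ is regarded as a constant. That is, for each $\delta\ge2$ there are constants $c_1,c_2>0$ depending only on $\delta$ such that every $(n,r,2,\delta,Q)$-MR code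 with $r\ge1$ and $n/(r+\delta-1)\ge 2$ satisfies $Q\ge c_1\,n\,r^{\min\{\delta-1,\,0\}}$, while every code of the construction with $r>2$ satisfies $q^b\le c_2\,n\,r^{\min\{\delta-1,\,0\}}$ with $n=q^b-1$. -/

import Mathlib

universe u

section Codes

variable {F : Type u} [Field F] {ι : Type*} [Fintype ι]

open Classical in
/-- The minimum Hamming distance of the linear code `C` is at least `d`
(the distance of the zero code is regarded as infinite). -/
def MinDistAtLeast (C : Submodule F (ι → F)) (d : ℕ) : Prop :=
  ∀ c ∈ C, c ≠ 0 → d ≤ hammingNorm c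

open Classical in
/-- The linear code `C` is nonzero and its minimum Hamming distance is exactly `d`. -/
def HasMinDist (C : Submodule F (ι → F)) (d : ℕ) : Prop :=
  MinDistAtLeast C d ∧ ∃ c ∈ C, c ≠ 0 ∧ hammingNorm c = d

/-- MDS codes: `d = n - k + 1`, where `n` is the length and `k` the dimension. -/
def IsMDS (C : Submodule F (ι → F)) : Prop :=
  HasMinDist C (Fintype.card ι - Module.finrank F C + 1)

/-- The punctured code `C|_S`, obtained by keeping only the coordinates in `S`. -/
def puncture (C : Submodule F (ι → F)) (S : Finset ι) : Submodule F (S → F) :=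
  C.map (LinearMap.funLeft F F (Subtype.val : S → ι))

/-- `S` is an `(r, δ)`-repair set of the `j`th code symbol of `C`. -/
def IsRepairSet (C : Submodule F (ι → F)) (r δ : ℕ) (j : ι) (S : Finset ι) : Prop :=
  j ∈ S ∧ S.card ≤ r + δ - 1 ∧ MinDistAtLeast (puncture C S) δ

/-- All-symbol `(r, δ)`-locality. -/
def HasAllSymbolLocality (C : Submodule F (ι → F)) (r δ : ℕ) : Prop :=
  ∀ j, ∃ S, IsRepairSet C r δ j S

/-- Optimal locally repairable codes with all-symbol `(r, δ)`-locality: the minimum distance `d`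
attains the Singleton-type bound `d ≤ n - k + 1 - (⌈k / r⌉ - 1) (δ - 1)` with equality. -/
def IsOptimalLRC (C : Submodule F (ι → F)) (r δ : ℕ) : Prop :=
  HasAllSymbolLocality C r δ ∧
    ∃ d : ℕ, HasMinDist C d ∧
      (d : ℤ) = (Fintype.card ι : ℤ) - (Module.finrank F C : ℤ) + 1
        - (⌈(Module.finrank F C : ℚ) / (r : ℚ)⌉ - 1) * ((δ : ℤ) - 1)

end Codes

section MR

variable {F : Type u} [Field F] {n : ℕ}

/-- `C` is an `(n, r, h, δ, q)`-MR code, `q` being the size of `F`: the coordinates are partitioned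
into repair sets of size `r + δ - 1`; whenever `δ - 1` coordinates are deleted from each of them,
the code punctured to the remaining set `R` of coordinates is MDS; and the dimension is
`m r - h` with `m = n / (r + δ - 1)`. -/
def IsMRCode (C : Submodule F (Fin n → F)) (r h δ : ℕ) : Prop :=
  (∃ P : Finpartition (Finset.univ : Finset (Fin n)),
    (∀ S ∈ P.parts, S.card = r + δ - 1 ∧ ∀ j ∈ S, IsRepairSet C r δ j S) ∧
    ∀ R : Finset (Fin n), (∀ S ∈ P.parts, (S \ R).card = δ - 1) → IsMDS (puncture C R)) ∧
  Module.finrank F C + h = n / (r + δ - 1) * r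

/-- `C` is closed under `(c_0, …, c_{n-1}) ↦ (c_{n-1}, c_0, …, c_{n-2})`. -/
def IsCyclicCode (C : Submodule F (Fin n → F)) : Prop :=
  ∀ c ∈ C, (fun i => c ((finRotate n).symm i)) ∈ C

/-- The `(n, r, h, δ, q)`-MR code `C` has optimal field size: no MR code with the same
`n, r, h, δ` exists over a smaller finite field. -/
def HasOptimalFieldSize (C : Submodule F (Fin n → F)) (r h δ : ℕ) : Prop :=
  IsMRCode C r h δ ∧
    ∀ (K : Type u) [Field K] [Finite K] (D : Submodule K (Fin n → K)),
      IsMRCode D r h δ → Nat.card F ≤ Nat.card K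

open Polynomial in
/-- The cyclic code of length `n` over `F` with root set `R` (a set of `n`th roots of unity):
the words `(c_0, …, c_{n-1})` for which `∑ c_i X^i` is a multiple of the generator polynomial
`∏_{ρ ∈ R} (X - ρ)`. -/
noncomputable def codeOfRoots (n : ℕ) (R : Finset F) : Submodule F (Fin n → F) where
  carrier := {c | (∏ ρ ∈ R, (X - C ρ)) ∣ ∑ i : Fin n, C (c i) * X ^ (i : ℕ)}
  add_mem' := by
    intro c d hc hd
    have h := dvd_add hc hd
    rw [← Finset.sum_add_distrib] at h
    simpa [add_mul] using h
  zero_mem' := by simp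
  smul_mem' := by
    intro a c hc
    have h := Dvd.dvd.mul_left hc (C a)
    rw [Finset.mul_sum] at h
    simpa [mul_assoc] using h

end MR

section Construction

variable {F : Type u} [Field F]

/-- The parameters of the construction: `F` is the field with `q ^ b` elements, `α` is a primitive
element of `F`, `n = q ^ b - 1`, `a = r + δ - 1` divides `q - 1`, and `m = n / a` is coprime
to `δ`. -/
structure ConstructionSetting (q b r δ : ℕ) (α : F) : Prop where
  prime_power : IsPrimePow q
  two_le_b : 2 ≤ b
  two_le_r : 2 ≤ r
  two_le_delta : 2 ≤ δ
  card_field : Nat.card F = q ^ b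
  primitive : IsPrimitiveRoot α (q ^ b - 1)
  dvd : r + δ - 1 ∣ q - 1
  coprime : Nat.Coprime δ ((q ^ b - 1) / (r + δ - 1))

open Classical in
/-- The root set `{α ^ (j a + t) : 1 ≤ j ≤ m, 1 ≤ t ≤ δ - 1} ∪ {1, α ^ δ}`, where
`a = r + δ - 1` and `m = (q ^ b - 1) / a`. -/
noncomputable def constructionRoots (q b r δ : ℕ) (α : F) : Finset F :=
  ((Finset.Icc 1 ((q ^ b - 1) / (r + δ - 1)) ×ˢ Finset.Icc 1 (δ - 1)).image
    fun p => α ^ (p.1 * (r + δ - 1) + p.2)) ∪ {1, α ^ δ}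

/-- The code of the construction: the cyclic code of length `q ^ b - 1` with the above root set. -/
noncomputable def constructedCode (q b r δ : ℕ) (α : F) :
    Submodule F (Fin (q ^ b - 1) → F) :=
  codeOfRoots (q ^ b - 1) (constructionRoots q b r δ α)

end Construction

/-- The expression `n r ^ min {δ - 1, h - 2}` in the field size lower bound
`q = Ω(n r ^ min {δ - 1, h - 2})` for `(n, r, h, δ, q)`-MR codes with `n / (r + δ - 1) ≥ h ≥ 2`
(constants depending on `h` and `δ` only). -/
def fieldSizeBound (n r h δ : ℕ) : ℝ := (n : ℝ) * (r : ℝ) ^ min (δ - 1) (h - 2)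

/-!
Let `a = r + δ - 1`, `n = q ^ b - 1` and `m = n / a`, and group the coordinates `0, …, n - 1` of the
constructed code by their residue modulo `m`. Evaluating a codeword at the roots
`α ^ (j a + t)`, `1 ≤ j ≤ m`, and inverting a Vandermonde system in `j` shows that these roots
impose, on each residue class `S`, the checks `∑ i ∈ S, c i * (α ^ i) ^ t = 0` for `1 ≤ t ≤ δ - 1`
(`local_power_sum_eq_zero`); hence the residue classes are repair sets. The roots `1` and `α ^ δ`
add the two global checks with `t = 0` and `t = δ`.

*Maximal recoverability* (`eq_zero_of_weight_le_two`). A codeword supported on `δ - 1` coordinates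
of each class and two further ones has to vanish. If the two lie in the same class, `δ + 1`
consecutive power sums of that class vanish. If they lie in different classes, let `A` and `A'` be
the sets of `δ` coordinates concerned. Pairing the codeword with `∏ i ∈ A, (X - α ^ i)` relates its
two global syndromes on `A` by the factor `∏ i ∈ A, α ^ i` up to sign
(`power_sum_card_add`). The two products for `A` and `A'` differ because their exponents are
`δ s` and `δ s'` modulo `m`, where `s ≠ s'` are the two residues, and `δ` is coprime to `m`; so
both syndromes vanish, and a Vandermonde system finishes the argument.

*Distance.* The consecutive roots `1, α, …, α ^ δ` give distance at least `δ + 2`. For `r > 2` a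
dimension count yields a word of that weight or less supported on one repair set
(`IsMRPartition.exists_hammingNorm_le`), and `δ + 2` is the value of the Singleton-type bound.

*Field size.* For an MR code over a field with `Q` elements and `m` repair sets, both lower bounds
on `Q` count cosets in a quotient of dimension two, which has `Q ^ 2`
elements (`card_mul_le_of_smul_sub_smul`). Deleting `δ - 1` coordinates from each repair set leaves
a code of codimension two and distance three, so the multiples of the unit vectors lie in distinct
cosets and `m r (Q - 1) ≤ Q ^ 2` (`IsMRPartition.card_parts_mul_le`). For `r = 2` one can do better:
for each coordinate `z` there is a word supported on the repair set of `z` minus `z` that is a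
codeword locally, and maximal recoverability separates the multiples of these `n` words
(`IsMRPartition.length_mul_le`). Thus `n ≤ Q + 1`, and `Q ≥ q ^ b` if the prime power `Q` can be
neither `q ^ b - 1` nor `q ^ b - 2`.
-/

section Generic

open scoped Classical
open Finset

variable {F : Type*} [Field F] {ι : Type*}

/-! ### Weights of punctured words and the Singleton argument -/

theorem mem_puncture {C : Submodule F (ι → F)} {S : Finset ι} {w : S → F} :
    w ∈ puncture C S ↔ ∃ c ∈ C, (fun i : S => c i) = w := Iff.rfl

theorem hammingNorm_restrict (c : ι → F) (S : Finset ι) :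
    hammingNorm (fun i : S => c i) = #{i ∈ S | c i ≠ 0} := by
  rw [hammingNorm, ← card_map (Function.Embedding.subtype _)]
  congr 1
  ext i
  simp [and_comm]

theorem minDistAtLeast_puncture_iff {C : Submodule F (ι → F)} {S : Finset ι} {d : ℕ} :
    MinDistAtLeast (puncture C S) d ↔
      ∀ c ∈ C, #{i ∈ S | c i ≠ 0} < d → ∀ i ∈ S, c i = 0 := by
  constructor
  · intro h c hc hlt i hi
    by_contra hne
    have := h (fun i : S => c i) (mem_puncture.2 ⟨c, hc, rfl⟩)
      (fun h0 => hne (congrFun h0 ⟨i, hi⟩))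
    rw [hammingNorm_restrict] at this
    omega
  · rintro h w hw hne
    obtain ⟨c, hc, rfl⟩ := mem_puncture.1 hw
    rw [hammingNorm_restrict]
    by_contra hlt
    exact hne (funext fun i => h c hc (not_le.1 hlt) i i.2)

theorem finrank_puncture {C : Submodule F (ι → F)} {R : Finset ι}
    (hC : ∀ c ∈ C, (∀ i ∈ R, c i = 0) → c = 0) :
    Module.finrank F (puncture C R) = Module.finrank F C := by
  let f : C →ₗ[F] (R → F) := (LinearMap.funLeft F F (Subtype.val : R → ι)) ∘ₗ C.subtype
  have hf : puncture C R = LinearMap.range f := by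
    rw [LinearMap.range_comp, Submodule.range_subtype]
    rfl
  rw [hf]
  refine LinearMap.finrank_range_of_inj ((injective_iff_map_eq_zero f).2 fun c hc => ?_)
  exact Subtype.ext (hC c c.2 fun i hi => congrFun hc ⟨i, hi⟩)

/-- The dimension count behind the Singleton bound. -/
theorem exists_ne_zero_of_card_lt_finrank [Fintype ι] {C : Submodule F (ι → F)} {Z : Finset ι}
    (h : #Z < Module.finrank F C) : ∃ c ∈ C, c ≠ 0 ∧ ∀ i ∈ Z, c i = 0 := by
  let f : C →ₗ[F] (Z → F) := (LinearMap.funLeft F F (Subtype.val : Z → ι)) ∘ₗ C.subtype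
  have hk : LinearMap.ker f ≠ ⊥ := LinearMap.ker_ne_bot_of_finrank_lt (by simpa using h)
  obtain ⟨c, hc, hne⟩ := Submodule.exists_mem_ne_zero_of_ne_bot hk
  exact ⟨c, c.2, fun h0 => hne (Subtype.ext h0), fun i hi => congrFun hc ⟨i, hi⟩⟩

/-- The Singleton bound. -/
theorem exists_hammingNorm_le [Fintype ι] {C : Submodule F (ι → F)}
    (h : 0 < Module.finrank F C) :
    ∃ c ∈ C, c ≠ 0 ∧ hammingNorm c ≤ Fintype.card ι - Module.finrank F C + 1 := by
  have hle : Module.finrank F C ≤ Fintype.card ι := by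
    simpa using Submodule.finrank_le C
  obtain ⟨Z, -, hZ⟩ := exists_subset_card_eq
    (s := (univ : Finset ι)) (n := Module.finrank F C - 1) (by rw [card_univ]; omega)
  obtain ⟨c, hc, hne, h0⟩ := exists_ne_zero_of_card_lt_finrank (C := C) (Z := Z) (by omega)
  refine ⟨c, hc, hne, ?_⟩
  have : hammingNorm c ≤ #(univ \ Z) := by
    refine card_le_card fun i hi => ?_
    simp only [mem_filter, mem_univ, true_and, mem_sdiff] at hi ⊢
    exact fun hiZ => hi (h0 i hiZ)
  rw [card_sdiff_of_subset (subset_univ _), card_univ] at this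
  omega

/-- A punctured code that loses no information and has redundancy `h` is MDS as soon as no nonzero
codeword has weight at most `h` on the remaining coordinates. -/
theorem isMDS_puncture_of_forall {C : Submodule F (ι → F)} {R : Finset ι} {h : ℕ}
    (hR : Module.finrank F C + h = #R) (hpos : 0 < Module.finrank F C)
    (hC : ∀ c ∈ C, #{i ∈ R | c i ≠ 0} ≤ h → c = 0) : IsMDS (puncture C R) := by
  have hrank : Module.finrank F (puncture C R) = Module.finrank F C :=
    finrank_puncture fun c hc h0 => hC c hc (by
      rw [filter_false_of_mem (by simpa using h0)]; simp)
  have hd : Fintype.card R - Module.finrank F (puncture C R) + 1 = h + 1 := by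
    rw [hrank, Fintype.card_coe]; omega
  have hmin : MinDistAtLeast (puncture C R) (h + 1) :=
    minDistAtLeast_puncture_iff.2 fun c hc hlt i _ =>
      congrFun (hC c hc (Nat.lt_succ_iff.1 hlt)) i
  obtain ⟨w, hw, hne, hle⟩ := exists_hammingNorm_le (C := puncture C R) (by omega)
  unfold IsMDS
  rw [hd] at hle ⊢
  exact ⟨hmin, w, hw, hne, le_antisymm hle (hmin w hw hne)⟩

/-! ### Partitions into repair sets -/

section Partition

variable {n : ℕ} {P : Finpartition (univ : Finset (Fin n))}

theorem sum_card_inter_parts (P : Finpartition (univ : Finset (Fin n))) (R : Finset (Fin n)) :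
    ∑ S ∈ P.parts, #(S ∩ R) = #R := by
  rw [← card_biUnion]
  · congr 1
    ext i
    obtain ⟨S, hS, hi⟩ := P.exists_mem (mem_univ i)
    simp only [mem_biUnion, mem_inter]
    exact ⟨fun ⟨_, _, _, h⟩ => h, fun h => ⟨S, hS, hi, h⟩⟩
  · intro S hS S' hS' hne
    exact (P.disjoint hS hS' hne).mono inter_subset_left inter_subset_left

theorem card_parts_mul {a : ℕ} (ha : ∀ S ∈ P.parts, #S = a) : #P.parts * a = n := by
  have := P.sum_card_parts
  rwa [sum_congr rfl ha, sum_const, smul_eq_mul, card_univ, Fintype.card_fin] at this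

theorem div_eq_card_parts {a : ℕ} (h0 : 0 < a) (ha : ∀ S ∈ P.parts, #S = a) :
    n / a = #P.parts :=
  Nat.div_eq_of_eq_mul_left h0 (card_parts_mul ha).symm

theorem card_inter_of_card_sdiff {r δ : ℕ} (hδ : 1 ≤ δ) {S R : Finset (Fin n)}
    (hS : #S = r + δ - 1) (hR : #(S \ R) = δ - 1) : #(S ∩ R) = r := by
  have := card_sdiff_add_card_inter S R
  omega

theorem card_transversal {r δ : ℕ} (hδ : 1 ≤ δ) (hP : ∀ S ∈ P.parts, #S = r + δ - 1)
    {R : Finset (Fin n)} (hR : ∀ S ∈ P.parts, #(S \ R) = δ - 1) : #R = #P.parts * r := by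
  rw [← sum_card_inter_parts P R,
    sum_congr rfl fun S hS => card_inter_of_card_sdiff hδ (hP S hS) (hR S hS), sum_const,
    smul_eq_mul]

/-- A set of at most `d` coordinates in each part can be avoided by the sets that miss exactly `d`
coordinates of each part. -/
theorem exists_disjoint_transversal {d : ℕ} {T : Finset (Fin n)}
    (hP : ∀ S ∈ P.parts, d ≤ #S) (hT : ∀ S ∈ P.parts, #(T ∩ S) ≤ d) :
    ∃ R : Finset (Fin n), (∀ i ∈ T, i ∉ R) ∧ ∀ S ∈ P.parts, #(S \ R) = d := by
  choose! E hTE hES hE using fun S (hS : S ∈ P.parts) =>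
    exists_subsuperset_card_eq (inter_subset_right : T ∩ S ⊆ S) (hT S hS) (hP S hS)
  refine ⟨(P.parts.biUnion E)ᶜ, fun i hi => ?_, fun S hS => ?_⟩
  · obtain ⟨S, hS, hiS⟩ := P.exists_mem (mem_univ i)
    simp only [mem_compl, mem_biUnion, not_not]
    exact ⟨S, hS, hTE S hS (mem_inter.2 ⟨hi, hiS⟩)⟩
  · rw [← hE S hS]
    congr 1
    ext i
    simp only [mem_sdiff, mem_compl, not_not, mem_biUnion]
    constructor
    · rintro ⟨hi, S', hS', hi'⟩
      rwa [P.eq_of_mem_parts hS hS' hi (hES S' hS' hi')]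
    · exact fun hi => ⟨hES S hS hi, S, hS, hi⟩

variable {D : Submodule F (Fin n → F)} {r h δ : ℕ}

/-- The parts of `P` are repair sets of size `r + δ - 1` for `D`: a codeword with fewer than `δ`
nonzero coordinates in a part vanishes on that part. -/
structure IsLocalPartition (D : Submodule F (Fin n → F))
    (P : Finpartition (univ : Finset (Fin n))) (r δ : ℕ) : Prop where
  card_eq : ∀ S ∈ P.parts, #S = r + δ - 1
  eq_zero : ∀ S ∈ P.parts, ∀ c ∈ D, #{i ∈ S | c i ≠ 0} < δ → ∀ i ∈ S, c i = 0

theorem IsLocalPartition.le_card (hP : IsLocalPartition D P r δ) :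
    ∀ S ∈ P.parts, δ - 1 ≤ #S := fun S hS => by
  have := hP.card_eq S hS
  have := card_pos.2 (P.nonempty_of_mem_parts hS)
  omega

theorem IsLocalPartition.exists_transversal (hP : IsLocalPartition D P r δ) :
    ∃ R : Finset (Fin n), ∀ S ∈ P.parts, #(S \ R) = δ - 1 := by
  obtain ⟨R, -, hR⟩ := exists_disjoint_transversal (T := ∅) hP.le_card (by simp)
  exact ⟨R, hR⟩

theorem IsLocalPartition.eq_zero_of_sdiff (hP : IsLocalPartition D P r δ) (hδ : 1 ≤ δ)
    {R S : Finset (Fin n)} (hS : S ∈ P.parts) (hR : #(S \ R) = δ - 1) {c : Fin n → F}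
    (hc : c ∈ D) (h0 : ∀ i ∈ S ∩ R, c i = 0) : ∀ i ∈ S, c i = 0 := by
  refine hP.eq_zero S hS c hc (lt_of_le_of_lt (card_le_card (t := S \ R) fun i hi => ?_)
    (by omega))
  obtain ⟨hiS, hne⟩ := mem_filter.1 hi
  exact mem_sdiff.2 ⟨hiS, fun hiR => hne (h0 i (mem_inter.2 ⟨hiS, hiR⟩))⟩

theorem IsLocalPartition.eq_zero_of_transversal (hP : IsLocalPartition D P r δ) (hδ : 1 ≤ δ)
    {R : Finset (Fin n)} (hR : ∀ S ∈ P.parts, #(S \ R) = δ - 1) {c : Fin n → F}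
    (hc : c ∈ D) (h0 : ∀ i ∈ R, c i = 0) : c = 0 := by
  funext i
  obtain ⟨S, hS, hi⟩ := P.exists_mem (mem_univ i)
  exact hP.eq_zero_of_sdiff hδ hS (hR S hS) hc (fun j hj => h0 j (mem_inter.1 hj).2) i hi

/-- The MR property relative to a given partition, phrased through vanishing of codewords. -/
structure IsMRPartition (D : Submodule F (Fin n → F))
    (P : Finpartition (univ : Finset (Fin n))) (r h δ : ℕ) : Prop
    extends IsLocalPartition D P r δ where
  finrank_add : Module.finrank F D + h = #P.parts * r
  eq_zero_of_weight_le : ∀ R : Finset (Fin n), (∀ S ∈ P.parts, #(S \ R) = δ - 1) →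
    ∀ c ∈ D, #{i ∈ R | c i ≠ 0} ≤ h → c = 0

theorem isMRCode_of_isMRPartition (hδ : 1 ≤ δ) (ha : 0 < r + δ - 1)
    (hP : IsMRPartition D P r h δ) (hpos : 0 < Module.finrank F D) : IsMRCode D r h δ := by
  refine ⟨⟨P, fun S hS => ⟨hP.card_eq S hS, fun j hj => ⟨hj, (hP.card_eq S hS).le,
    minDistAtLeast_puncture_iff.2 (hP.eq_zero S hS)⟩⟩, fun R hR => ?_⟩, ?_⟩
  · exact isMDS_puncture_of_forall
      (by rw [hP.finrank_add, card_transversal hδ hP.card_eq hR]) hpos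
      (hP.eq_zero_of_weight_le R hR)
  · rw [hP.finrank_add, div_eq_card_parts ha hP.card_eq]

theorem IsMRCode.exists_isMRPartition (hδ : 1 ≤ δ) (ha : 0 < r + δ - 1)
    (hD : IsMRCode D r h δ) : ∃ P, IsMRPartition D P r h δ := by
  obtain ⟨⟨P, hloc, hmds⟩, hrank⟩ := hD
  have hP : IsLocalPartition D P r δ := ⟨fun S hS => (hloc S hS).1, fun S hS => by
    obtain ⟨j, hj⟩ := P.nonempty_of_mem_parts hS
    exact minDistAtLeast_puncture_iff.1 ((hloc S hS).2 j hj).2.2⟩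
  rw [div_eq_card_parts ha hP.card_eq] at hrank
  refine ⟨P, hP, hrank, fun R hR c hc hle => ?_⟩
  have hinj : ∀ c ∈ D, (∀ i ∈ R, c i = 0) → c = 0 :=
    fun c hc h0 => hP.eq_zero_of_transversal hδ hR hc h0
  have hmin := (hmds R hR).1
  rw [finrank_puncture hinj, Fintype.card_coe, card_transversal hδ hP.card_eq hR, ← hrank,
    Nat.add_sub_cancel_left] at hmin
  exact hinj c hc (minDistAtLeast_puncture_iff.1 hmin c hc (Nat.lt_succ_of_le hle))

/-- Maximal recoverability: `δ - 1` erasures in each repair set and `h` further ones are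
correctable. -/
theorem IsMRPartition.eq_zero_of_support (hP : IsMRPartition D P r h δ)
    {T X : Finset (Fin n)} (hT : ∀ S ∈ P.parts, #(T ∩ S) ≤ δ - 1) (hX : #X ≤ h)
    {c : Fin n → F} (hc : c ∈ D) (h0 : ∀ i, i ∉ T → i ∉ X → c i = 0) : c = 0 := by
  obtain ⟨R, hTR, hR⟩ := exists_disjoint_transversal hP.le_card hT
  refine hP.eq_zero_of_weight_le R hR c hc ((card_le_card fun i hi => ?_).trans hX)
  obtain ⟨hiR, hne⟩ := mem_filter.1 hi
  by_contra hiX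
  exact hne (h0 i (fun hiT => hTR i hiT hiR) hiX)

end Partition

end Generic

section Bounds

open scoped Classical
open Finset

/-! ### Counting cosets: lower bounds on the field size -/

/-- If the nonzero multiples of the vectors `w i` lie in pairwise distinct cosets of a subspace of
codimension at most two, there are at most `|K| ^ 2` of them. -/
theorem card_mul_le_of_smul_sub_smul {K V I : Type*} [Field K] [Finite K] [AddCommGroup V]
    [Module K V] [Module.Finite K V] [Fintype I] {W : Submodule K V}
    (hW : Module.finrank K V ≤ Module.finrank K W + 2) (w : I → V)
    (hw : ∀ i j, ∀ x y : Kˣ, (x : K) • w i - (y : K) • w j ∈ W → i = j ∧ x = y) :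
    Fintype.card I * (Nat.card K - 1) ≤ Nat.card K ^ 2 := by
  have hfin : Finite (V ⧸ W) := Module.finite_of_finite K
  have hinj : Function.Injective fun p : I × Kˣ => W.mkQ ((p.2 : K) • w p.1) := by
    rintro ⟨i, x⟩ ⟨j, y⟩ hij
    obtain ⟨rfl, rfl⟩ := hw i j x y ((Submodule.Quotient.eq W).1 hij)
    rfl
  have hcard := Nat.card_le_card_of_injective _ hinj
  rw [Nat.card_prod, Nat.card_eq_fintype_card, Nat.card_units,
    Module.natCard_eq_pow_finrank (K := K) (V := V ⧸ W)] at hcard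
  refine hcard.trans (Nat.pow_le_pow_right Nat.card_pos ?_)
  have := Submodule.finrank_quotient_add_finrank W
  omega

variable {K : Type*} [Field K] {n r δ : ℕ} {D : Submodule K (Fin n → K)}
  {P : Finpartition (univ : Finset (Fin n))}

/-- Puncturing an MR code with `h = 2` to a transversal `R` leaves a code of codimension two and
distance three; the multiples of the unit vectors then lie in distinct cosets. -/
theorem IsMRPartition.card_parts_mul_le [Finite K] (hP : IsMRPartition D P r 2 δ)
    (hδ : 1 ≤ δ) : #P.parts * r * (Nat.card K - 1) ≤ Nat.card K ^ 2 := by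
  obtain ⟨R, hR⟩ := hP.exists_transversal
  have hinj : ∀ c ∈ D, (∀ i ∈ R, c i = 0) → c = 0 :=
    fun c hc h0 => hP.eq_zero_of_transversal hδ hR hc h0
  have hcard := card_transversal hδ hP.card_eq hR
  have := card_mul_le_of_smul_sub_smul (W := puncture D R)
    (by rw [finrank_puncture hinj, hP.finrank_add, ← hcard]; simp)
    (fun i : R => (Pi.single i 1 : R → K)) ?_
  · rwa [Fintype.card_coe, hcard] at this
  intro i j x y hxy
  obtain ⟨c, hc, hcR⟩ := mem_puncture.1 hxy
  have hval : ∀ k : R, c k = x * (Pi.single i 1 : R → K) k - y * (Pi.single j 1 : R → K) k :=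
    fun k => congrFun hcR k
  have h0 : c = 0 := by
    refine hP.eq_zero_of_weight_le R hR c hc
      ((card_le_card (t := {(i : Fin n), (j : Fin n)}) fun k hk => ?_).trans card_le_two)
    obtain ⟨hkR, hne⟩ := mem_filter.1 hk
    by_contra hij
    simp only [mem_insert, mem_singleton, not_or] at hij
    refine hne ((hval ⟨k, hkR⟩).trans ?_)
    rw [Pi.single_eq_of_ne (by rintro rfl; exact hij.1 rfl),
      Pi.single_eq_of_ne (by rintro rfl; exact hij.2 rfl)]
    simp
  have hi := hval i
  by_cases hij : i = j
  · subst hij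
    simp only [h0, Pi.zero_apply, Pi.single_eq_same, mul_one] at hi
    exact ⟨rfl, Units.ext (sub_eq_zero.1 hi.symm)⟩
  · simp only [h0, Pi.zero_apply, Pi.single_eq_same, Pi.single_eq_of_ne hij, mul_one, mul_zero,
      sub_zero] at hi
    exact absurd hi.symm x.ne_zero

/-- For `r = 2` some codeword vanishes at a prescribed coordinate `z` without vanishing on the
repair set of `z`. -/
theorem IsMRPartition.exists_eq_zero_ne_zero (hP : IsMRPartition D P 2 2 δ) (hδ : 1 ≤ δ)
    (hm : 2 ≤ #P.parts) (z : Fin n) :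
    ∃ c ∈ D, c z = 0 ∧ ∃ i ∈ P.part z, c i ≠ 0 := by
  obtain ⟨R, hR⟩ := hP.exists_transversal
  have hz : P.part z ∈ P.parts := P.part_mem.2 (mem_univ z)
  have hcard := card_transversal hδ hP.card_eq hR
  have hRz := card_inter_of_card_sdiff hδ (hP.card_eq _ hz) (hR _ hz)
  have hsd := card_sdiff_add_card_inter R (P.part z)
  rw [inter_comm] at hsd
  -- Two coordinates of `R` outside the repair set are left free; the others are set to zero.
  obtain ⟨X, hXR, hX⟩ := exists_subset_card_eq (s := R \ P.part z) (n := 2) (by omega)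
  have hZ := card_insert_le z ((R \ P.part z) \ X)
  have hZX := card_sdiff_of_subset hXR
  have hrank := hP.finrank_add
  obtain ⟨c, hc, hne, h0⟩ := exists_ne_zero_of_card_lt_finrank (C := D)
    (Z := insert z ((R \ P.part z) \ X)) (by omega)
  refine ⟨c, hc, h0 z (mem_insert_self _ _), ?_⟩
  by_contra! hS
  refine hne (hP.eq_zero_of_weight_le R hR c hc ((card_le_card fun i hi => ?_).trans hX.le))
  obtain ⟨hiR, hci⟩ := mem_filter.1 hi
  by_contra hiX
  by_cases hiS : i ∈ P.part z
  · exact hci (hS i hiS)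
  · exact hci (h0 i (mem_insert_of_mem (mem_sdiff.2 ⟨mem_sdiff.2 ⟨hiR, hiS⟩, hiX⟩)))

/-- A word that agrees on each part with some codeword, and agrees with a codeword on a
transversal, is that codeword. -/
theorem IsLocalPartition.eq_of_locally_mem (hP : IsLocalPartition D P r δ) (hδ : 1 ≤ δ)
    {R : Finset (Fin n)} (hR : ∀ S ∈ P.parts, #(S \ R) = δ - 1) {c v : Fin n → K} (hc : c ∈ D)
    (hv : ∀ S ∈ P.parts, ∃ d ∈ D, ∀ i ∈ S, v i = d i) (h : ∀ i ∈ R, c i = v i) : c = v := by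
  funext i
  obtain ⟨S, hS, hi⟩ := P.exists_mem (mem_univ i)
  obtain ⟨d, hd, hvd⟩ := hv S hS
  have := hP.eq_zero_of_sdiff hδ hS (hR S hS) (D.sub_mem hc hd) (fun j hj => by
    rw [Pi.sub_apply, ← hvd j (mem_inter.1 hj).1, h j (mem_inter.1 hj).2, sub_self]) i hi
  rw [hvd i hi]
  exact sub_eq_zero.1 this

/-- For `r = 2` each coordinate `z` gives a word supported on its repair set minus `z`, and the
multiples of all these words lie in distinct cosets of the code, which has codimension two in the
space of words that are locally codewords. -/
theorem IsMRPartition.length_mul_le [Finite K] (hP : IsMRPartition D P 2 2 δ) (hδ : 2 ≤ δ)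
    (hm : 2 ≤ #P.parts) : n * (Nat.card K - 1) ≤ Nat.card K ^ 2 := by
  have hδ' : 1 ≤ δ := by omega
  obtain ⟨R, hR⟩ := hP.exists_transversal
  have hinj : ∀ c ∈ D, (∀ i ∈ R, c i = 0) → c = 0 :=
    fun c hc h0 => hP.eq_zero_of_transversal hδ' hR hc h0
  have hcard := card_transversal hδ' hP.card_eq hR
  have hpart : ∀ z, P.part z ∈ P.parts := fun z => P.part_mem.2 (mem_univ z)
  have hself : ∀ z, z ∈ P.part z := fun z => P.mem_part_self.2 (mem_univ z)
  choose c hcD hcz k hk hck using fun z => hP.exists_eq_zero_ne_zero hδ' hm z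
  let u : Fin n → Fin n → K := fun z i => if i ∈ P.part z then c z i else 0
  have huz : ∀ z, u z z = 0 := fun z => by simp [u, hcz]
  have huk : ∀ z, u z (k z) ≠ 0 := fun z => by simpa [u, hk] using hck z
  have hu0 : ∀ z i, i ∉ P.part z → u z i = 0 := fun z i hi => by simp [u, hi]
  have hloc : ∀ z, ∀ S ∈ P.parts, ∃ d ∈ D, ∀ i ∈ S, u z i = d i := by
    intro z S hS
    by_cases hSz : S = P.part z
    · exact ⟨c z, hcD z, fun i hi => by simp [u, hSz ▸ hi]⟩
    · refine ⟨0, D.zero_mem, fun i hi => hu0 z i fun hi' => hSz ?_⟩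
      exact P.eq_of_mem_parts hS (hpart z) hi hi'
  have := card_mul_le_of_smul_sub_smul (W := puncture D R)
    (by rw [finrank_puncture hinj, hP.finrank_add, ← hcard]; simp)
    (fun z : Fin n => fun i : R => u z i) ?_
  · rwa [Fintype.card_fin] at this
  intro z z' x y hxy
  obtain ⟨d, hd, hdR⟩ := mem_puncture.1 hxy
  have hdv : d = (x : K) • u z - (y : K) • u z' := by
    refine hP.eq_of_locally_mem hδ' hR hd (fun S hS => ?_) fun i hi => congrFun hdR ⟨i, hi⟩
    obtain ⟨d₁, hd₁, h₁⟩ := hloc z S hS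
    obtain ⟨d₂, hd₂, h₂⟩ := hloc z' S hS
    exact ⟨(x : K) • d₁ - (y : K) • d₂,
      D.sub_mem (D.smul_mem _ hd₁) (D.smul_mem _ hd₂), fun i hi => by
        simp [h₁ i hi, h₂ i hi]⟩
  have hdi : ∀ i, d i = x * u z i - y * u z' i := fun i => by rw [hdv]; rfl
  have hcardz : ∀ z, #(P.part z) = δ + 1 := fun z => by rw [hP.card_eq _ (hpart z)]; omega
  by_cases hzz : P.part z = P.part z'
  · -- The support lies in a single repair set, of size `δ + 1`.
    obtain ⟨X, hXS, hX⟩ := exists_subset_card_eq (s := P.part z) (n := 2) (by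
      rw [hcardz]; omega)
    have hd0 : d = 0 := by
      refine hP.eq_zero_of_support (T := P.part z \ X) (X := X) (fun S hS => ?_) hX.le hd
        fun i hiT hiX => ?_
      · refine (card_le_card inter_subset_left).trans ?_
        rw [card_sdiff_of_subset hXS, hcardz]
        omega
      · have hi : i ∉ P.part z := fun hi => hiT (mem_sdiff.2 ⟨hi, hiX⟩)
        rw [hdi, hu0 z i hi, hu0 z' i (hzz ▸ hi)]
        simp
    have heq : ∀ i, (x : K) * u z i = y * u z' i := fun i => by
      rw [← sub_eq_zero, ← hdi, hd0]; rfl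
    by_cases hz : z = z'
    · subst hz
      exact ⟨rfl, Units.ext (mul_right_cancel₀ (huk z) (heq (k z)))⟩
    · -- Two proportional words of the same repair set would vanish at both `z` and `z'`.
      exfalso
      have hz'0 : u z z' = 0 := by
        have := heq z'
        rw [huz, mul_zero] at this
        exact (mul_eq_zero.1 this).resolve_left x.ne_zero
      have hz'S : z' ∈ P.part z := hzz ▸ hself z'
      refine hck z (hP.eq_zero _ (hpart z) (c z) (hcD z) (lt_of_le_of_lt (card_le_card
        (t := ((P.part z).erase z).erase z') fun i hi => ?_) ?_) (k z) (hk z))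
      · obtain ⟨hiS, hne⟩ := mem_filter.1 hi
        refine mem_erase.2 ⟨?_, mem_erase.2 ⟨?_, hiS⟩⟩
        · rintro rfl
          exact hne (by simpa [u, hz'S] using hz'0)
        · rintro rfl
          exact hne (hcz i)
      · rw [card_erase_of_mem (mem_erase.2 ⟨Ne.symm hz, hz'S⟩), card_erase_of_mem (hself z),
          hcardz]
        omega
  · -- The support lies in two repair sets, with `δ` coordinates in each.
    exfalso
    have hdisj : Disjoint (P.part z) (P.part z') := P.disjoint (hpart z) (hpart z') hzz
    have hkz : ∀ z, k z ≠ z := fun z h => huk z (by rw [h, huz])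
    have hE : ∀ z, #(((P.part z).erase z).erase (k z)) = δ - 1 := fun z => by
      rw [card_erase_of_mem (mem_erase.2 ⟨hkz z, hk z⟩), card_erase_of_mem (hself z), hcardz]
      omega
    have hsub : ∀ z, ((P.part z).erase z).erase (k z) ⊆ P.part z := fun z =>
      (erase_subset _ _).trans (erase_subset _ _)
    have hd0 : d = 0 := by
      refine hP.eq_zero_of_support (T := ((P.part z).erase z).erase (k z) ∪
        ((P.part z').erase z').erase (k z')) (X := {k z, k z'}) (fun S hS => ?_) card_le_two hd
        fun i hiT hiX => ?_
      · by_cases hSz : S = P.part z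
        · rw [union_inter_distrib_right, hSz,
            disjoint_iff_inter_eq_empty.1 (hdisj.symm.mono_left (hsub z')), union_empty]
          exact (card_le_card inter_subset_left).trans (hE z).le
        · have hzS : Disjoint (P.part z) S := P.disjoint (hpart z) hS (Ne.symm hSz)
          rw [union_inter_distrib_right,
            disjoint_iff_inter_eq_empty.1 (hzS.mono_left (hsub z)), empty_union]
          exact (card_le_card inter_subset_left).trans (hE z').le
      · simp only [mem_union, mem_erase, mem_insert, mem_singleton, not_or, not_and] at hiT hiX
        have hzero : ∀ w, (i ≠ k w → i ≠ w → i ∉ P.part w) → i ≠ k w → u w i = 0 := by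
          intro w hw hik
          by_cases hiw : i = w
          · rw [hiw, huz]
          · exact hu0 w i (hw hik hiw)
        rw [hdi, hzero z hiT.1 hiX.1, hzero z' hiT.2 hiX.2]
        simp
    have h1 := hdi (k z)
    rw [hd0, hu0 z' (k z) (disjoint_left.1 hdisj (hk z)), mul_zero, sub_zero] at h1
    exact mul_ne_zero x.ne_zero (huk z) h1.symm

end Bounds

section Construction

open scoped Classical
open Finset Polynomial

variable {F : Type*} [Field F]

/-! ### Cyclic codes given by their roots -/

theorem mem_codeOfRoots {n : ℕ} {R : Finset F} {c : Fin n → F} :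
    c ∈ codeOfRoots n R ↔ ∀ ρ ∈ R, ∑ i : Fin n, c i * ρ ^ (i : ℕ) = 0 := by
  have key : ∀ ρ : F, (X - C ρ) ∣ ∑ i : Fin n, C (c i) * X ^ (i : ℕ) ↔
      ∑ i : Fin n, c i * ρ ^ (i : ℕ) = 0 := fun ρ => by
    rw [dvd_iff_isRoot, IsRoot.def, eval_finsetSum]
    simp
  change (∏ ρ ∈ R, (X - C ρ)) ∣ ∑ i : Fin n, C (c i) * X ^ (i : ℕ) ↔ _
  constructor
  · exact fun h ρ hρ => (key ρ).1 
      ((dvd_prod_of_mem (fun ρ => X - C ρ) hρ).trans h)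
  · refine fun h => Finset.prod_dvd_of_coprime (fun x _ y _ hxy => ?_)
      fun ρ hρ => (key ρ).2 (h ρ hρ)
    exact isCoprime_X_sub_C_of_isUnit_sub (sub_ne_zero.2 hxy).isUnit

theorem finrank_codeOfRoots_add_card {n : ℕ} {R : Finset F} (hR : #R ≤ n) :
    Module.finrank F (codeOfRoots n R) + #R = n := by
  let f : (Fin n → F) →ₗ[F] (R → F) :=
    (Matrix.of fun (ρ : R) (i : Fin n) => (ρ : F) ^ (i : ℕ)).mulVecLin
  have hf : ∀ c ρ, f c ρ = ∑ i : Fin n, c i * (ρ : F) ^ (i : ℕ) := fun c ρ => by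
    simp [f, Matrix.mulVec, dotProduct, mul_comm]
  have hker : LinearMap.ker f = codeOfRoots n R := by
    ext c
    rw [LinearMap.mem_ker, mem_codeOfRoots, funext_iff]
    simp [hf]
  -- Surjectivity is Lagrange interpolation.
  have hsurj : Function.Surjective f := by
    intro v
    let v' : F → F := fun x => if hx : x ∈ R then v ⟨x, hx⟩ else 0
    have hinj : Set.InjOn (id : F → F) R := Function.injective_id.injOn
    have hdeg := Lagrange.degree_interpolate_lt v' hinj
    refine ⟨fun i => (Lagrange.interpolate R id v').coeff i, funext fun ρ => ?_⟩
    have hev := Lagrange.eval_interpolate_at_node v' hinj ρ.2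
    rw [hf, Fin.sum_univ_eq_sum_range
      (fun i => (Lagrange.interpolate R id v').coeff i * (ρ : F) ^ i)]
    rw [eval_eq_sum_range' (n := n)] at hev
    · simpa [v'] using hev
    · by_cases h0 : Lagrange.interpolate R id v' = 0
      · rw [h0, natDegree_zero]
        exact lt_of_lt_of_le (card_pos.2 ⟨(ρ : F), ρ.2⟩) hR
      · exact (natDegree_lt_iff_degree_lt h0).2 (hdeg.trans_le (by exact_mod_cast hR))
  have := LinearMap.finrank_range_add_finrank_ker f
  rw [hker, LinearMap.range_eq_top.2 hsurj, finrank_top] at this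
  simp only [Module.finrank_fintype_fun_eq_card, Fintype.card_coe, Fintype.card_fin] at this
  omega

theorem isCyclicCode_codeOfRoots {n : ℕ} {R : Finset F} (hR : ∀ ρ ∈ R, ρ ^ n = 1) :
    IsCyclicCode (codeOfRoots n R) := by
  intro c hc
  rw [mem_codeOfRoots] at hc ⊢
  intro ρ hρ
  rw [← Equiv.sum_comp (finRotate n)]
  have : ∀ i : Fin n, ρ ^ ((finRotate n i : Fin n) : ℕ) = ρ ^ (i : ℕ) * ρ := by
    intro i
    rcases n with _ | n
    · exact i.elim0
    · rw [coe_finRotate, ← pow_succ]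
      split_ifs with h
      · rw [h, Fin.val_last, hR ρ hρ, pow_zero]
      · rfl
  simp only [Equiv.symm_apply_apply, this, ← mul_assoc]
  rw [← sum_mul, hc ρ hρ, zero_mul]

/-! ### Vandermonde systems -/

theorem sum_mul_eval_eq_zero {ι : Type*} {S : Finset ι} {c y : ι → F} {s d : ℕ}
    (h : ∀ t < d, ∑ i ∈ S, c i * y i ^ (s + t) = 0) {p : F[X]} (hp : p.natDegree < d) :
    ∑ i ∈ S, c i * y i ^ s * p.eval (y i) = 0 := by
  simp only [eval_eq_sum_range' hp, mul_sum]
  rw [sum_comm]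
  refine sum_eq_zero fun t ht => ?_
  have := congrArg (p.coeff t * ·) (h t (mem_range.1 ht))
  simp only [mul_sum, mul_zero] at this
  rw [← this]
  refine sum_congr rfl fun i _ => ?_
  ring

/-- A vector of weight at most `d` with `d` consecutive vanishing power sums vanishes. -/
theorem eq_zero_of_power_sums {ι : Type*} {S : Finset ι} {c y : ι → F} {s d : ℕ}
    (hy : Set.InjOn y S) (hy0 : ∀ i ∈ S, y i ≠ 0)
    (h : ∀ t < d, ∑ i ∈ S, c i * y i ^ (s + t) = 0) (hc : #{i ∈ S | c i ≠ 0} ≤ d) :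
    ∀ i ∈ S, c i = 0 := by
  intro i hi
  by_contra hne
  have hiT : i ∈ ({i ∈ S | c i ≠ 0} : Finset ι) := mem_filter.2 ⟨hi, hne⟩
  -- Pair the vector with the polynomial vanishing at the rest of its support.
  have := sum_mul_eval_eq_zero h
    (p := ∏ j ∈ ({i ∈ S | c i ≠ 0} : Finset ι).erase i, (X - C (y j))) (by
      rw [natDegree_prod_of_monic _ _ fun j _ => monic_X_sub_C _]
      simp only [natDegree_X_sub_C, sum_const, smul_eq_mul, mul_one]
      exact (card_erase_lt_of_mem hiT).trans_le hc)
  rw [sum_eq_single_of_mem i hi] at this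
  · rw [eval_prod] at this
    refine mul_ne_zero (mul_ne_zero hne (pow_ne_zero _ (hy0 i hi)))
      (prod_ne_zero_iff.2 fun j hj => ?_) this
    obtain ⟨hji, hjS⟩ := mem_erase.1 hj
    rw [eval_sub, eval_X, eval_C]
    exact sub_ne_zero.2 fun hij => hji (hy hi (mem_filter.1 hjS).1 hij).symm
  · intro j hj hji
    by_cases hcj : c j = 0
    · simp [hcj]
    · rw [eval_prod, prod_eq_zero (mem_erase.2 ⟨hji, mem_filter.2 ⟨hj, hcj⟩⟩), mul_zero]
      simp

/-- If the power sums of exponents `1, …, #A - 1` vanish, those of exponents `0` and `#A` are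
proportional, the factor being the product of the nodes up to sign. -/
theorem power_sum_card_add {ι : Type*} {A : Finset ι} {c y : ι → F}
    (hA : 0 < #A) (h : ∀ t, 1 ≤ t → t < #A → ∑ i ∈ A, c i * y i ^ t = 0) :
    ∑ i ∈ A, c i * y i ^ #A + (-1) ^ #A * (∏ i ∈ A, y i) * ∑ i ∈ A, c i = 0 := by
  set p : F[X] := ∏ j ∈ A, (X - C (y j)) with hp
  have hmonic : p.Monic := monic_prod_of_monic _ _ fun j _ => monic_X_sub_C _
  have hdeg : p.natDegree = #A := by
    rw [hp, natDegree_prod_of_monic _ _ fun j _ => monic_X_sub_C _]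
    simp
  have hcoeff : p.coeff 0 = (-1) ^ #A * ∏ i ∈ A, y i := by
    rw [coeff_zero_eq_eval_zero, hp, eval_prod]
    simp [prod_neg]
  have hsum : ∑ i ∈ A, c i * p.eval (y i) = 0 := sum_eq_zero fun i hi => by
    rw [hp, eval_prod, prod_eq_zero hi (by simp), mul_zero]
  have hlead : p.coeff #A = 1 := hdeg ▸ hmonic.coeff_natDegree
  simp only [eval_eq_sum_range, hdeg, mul_sum] at hsum
  rw [sum_comm, sum_range_succ, ← Nat.succ_pred_eq_of_pos hA, Nat.succ_eq_add_one,
    sum_range_succ', Nat.pred_eq_sub_one, Nat.sub_add_cancel hA] at hsum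
  rw [sum_eq_zero, zero_add, hlead, hcoeff] at hsum
  · rw [← hsum, add_comm, mul_sum]
    congr 1
    · exact sum_congr rfl fun i _ => by ring
    · exact sum_congr rfl fun i _ => by ring
  · intro t ht
    have h1 := h (t + 1) (by omega) (by have := mem_range.1 ht; omega)
    have := congrArg (p.coeff (t + 1) * ·) h1
    simp only [mul_sum, mul_zero] at this
    rw [← this]
    exact sum_congr rfl fun i _ => by ring

/-! ### Residue classes as repair sets -/

section Residues

variable {n m a : ℕ} {α : F}

/-- The coordinates `0, …, n - 1`, grouped by their residue modulo `m`. -/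
noncomputable def residuePartition (n m : ℕ) : Finpartition (univ : Finset (Fin n)) :=
  Finpartition.ofSetoid (Setoid.ker fun i : Fin n => (i : ℕ) % m)

theorem exists_residue_of_mem_parts (hm : 0 < m) {S : Finset (Fin n)}
    (hS : S ∈ (residuePartition n m).parts) :
    ∃ s < m, S = ({i | (i : ℕ) % m = s} : Finset (Fin n)) := by
  obtain ⟨j, hj⟩ := (residuePartition n m).nonempty_of_mem_parts hS
  refine ⟨(j : ℕ) % m, Nat.mod_lt _ hm, ?_⟩
  rw [← (residuePartition n m).part_eq_of_mem hS hj]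
  ext i
  rw [residuePartition, Finpartition.mem_part_ofSetoid_iff_rel, Setoid.ker_def, mem_filter]
  simp [eq_comm]

theorem card_residue (hn : m * a = n) {s : ℕ} (hs : s < m) :
    #({i | (i : ℕ) % m = s} : Finset (Fin n)) = a := by
  have hm : 0 < m := by omega
  have h := Nat.count_modEq_card n hm s
  rw [← hn, Nat.mul_mod_right, Nat.mul_div_cancel_left _ hm, if_neg (Nat.not_lt_zero _),
    add_zero, Nat.count_eq_card_filter_range, hn] at h
  rw [← h, ← card_map Fin.valEmbedding]
  congr 1
  ext i
  simp only [mem_map, mem_filter, mem_univ, true_and, Fin.valEmbedding_apply, mem_range,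
    Nat.ModEq, Nat.mod_eq_of_lt hs]
  exact ⟨fun ⟨j, hj, hji⟩ => hji ▸ ⟨j.2, hj⟩, fun ⟨h1, h2⟩ => ⟨⟨i, h1⟩, h2, rfl⟩⟩

theorem card_of_mem_parts (hn : m * a = n) (hm : 0 < m) :
    ∀ S ∈ (residuePartition n m).parts, #S = a := by
  intro S hS
  obtain ⟨s, hs, rfl⟩ := exists_residue_of_mem_parts hm hS
  exact card_residue hn hs

/-- Vanishing at all the roots `α ^ (j a + t)`, `1 ≤ j ≤ m`, amounts to one parity check on
each residue class. -/
theorem local_power_sum_eq_zero (hα : IsPrimitiveRoot α n) (hn : m * a = n) (h0 : 0 < n)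
    {c : Fin n → F} {t : ℕ}
    (hc : ∀ j, 1 ≤ j → j ≤ m → ∑ i : Fin n, c i * (α ^ (j * a + t)) ^ (i : ℕ) = 0) :
    ∀ S ∈ (residuePartition n m).parts, ∑ i ∈ S, c i * (α ^ (i : ℕ)) ^ t = 0 := by
  have ha : 0 < a := Nat.pos_of_ne_zero (by rintro rfl; omega)
  have hm : 0 < m := Nat.pos_of_ne_zero (by rintro rfl; omega)
  have hα0 : α ≠ 0 := hα.ne_zero h0.ne'
  have hpow : ∀ i : ℕ, α ^ (a * i) = α ^ (a * (i % m)) := fun i => by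
    conv_lhs => rw [← Nat.mod_add_div i m]
    rw [mul_add, pow_add, ← mul_assoc, mul_comm a m, hn, pow_mul α n, hα.pow_eq_one, one_pow,
      mul_one]
  have key := eq_zero_of_power_sums (S := range m) (s := 1) (d := m)
    (c := fun s => ∑ i ∈ ({i | (i : ℕ) % m = s} : Finset (Fin n)), c i * (α ^ (i : ℕ)) ^ t)
    (y := fun s => α ^ (a * s)) ?_ (fun _ _ => pow_ne_zero _ hα0) ?_
    ((card_filter_le _ _).trans (card_range m).le)
  · intro S hS
    obtain ⟨s, hs, rfl⟩ := exists_residue_of_mem_parts hm hS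
    exact key s (mem_range.2 hs)
  · intro s hs s' hs' h
    have hlt : ∀ s ∈ range m, a * s < n := fun s hs => by
      rw [← hn, mul_comm m]
      exact Nat.mul_lt_mul_of_pos_left (mem_range.1 hs) ha
    exact Nat.eq_of_mul_eq_mul_left ha (hα.pow_inj (hlt s hs) (hlt s' hs') h)
  · intro t' ht'
    rw [← hc (1 + t') (by omega) (by omega),
      ← sum_fiberwise_of_maps_to (s := univ) (t := range m) (g := fun i : Fin n => (i : ℕ) % m)
        fun i _ => mem_range.2 (Nat.mod_lt _ hm)]
    refine sum_congr rfl fun s _ => ?_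
    rw [sum_mul]
    refine sum_congr rfl fun i hi => ?_
    rw [← (mem_filter.1 hi).2, ← hpow, mul_assoc]
    congr 1
    simp only [← pow_mul, ← pow_add]
    congr 1
    ring

theorem injective_pow_val (hα : IsPrimitiveRoot α n) :
    Function.Injective fun i : Fin n => α ^ (i : ℕ) :=
  fun i j h => Fin.ext (hα.pow_inj i.2 j.2 h)

/-- Nodes taken from `δ` coordinates of one residue class never have the same product as those
from `δ` coordinates of another class, as `δ` is coprime to the modulus. -/
theorem prod_pow_ne_of_residue_ne (hα : IsPrimitiveRoot α n) (hn0 : n ≠ 0) (hn : m ∣ n)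
    {δ : ℕ}
    (hδ : Nat.Coprime δ m) {s s' : ℕ} (hs : s < m) (hs' : s' < m) (hss : s ≠ s')
    {A A' : Finset (Fin n)} (hA : #A = δ) (hA' : #A' = δ) (hAs : ∀ i ∈ A, (i : ℕ) % m = s)
    (hAs' : ∀ i ∈ A', (i : ℕ) % m = s') :
    ∏ i ∈ A, α ^ (i : ℕ) ≠ ∏ i ∈ A', α ^ (i : ℕ) := by
  rw [prod_pow_eq_pow_sum, prod_pow_eq_pow_sum]
  intro h
  rw [(hα.isOfFinOrder hn0).pow_eq_pow_iff_modEq, ← hα.eq_orderOf] at h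
  have hsum : ∀ (A : Finset (Fin n)) (s : ℕ), #A = δ → s < m → (∀ i ∈ A, (i : ℕ) % m = s) →
      ∑ i ∈ A, (i : ℕ) ≡ δ * s [MOD m] := by
    intro A s hA hs hAs
    rw [Nat.ModEq, sum_nat_mod, sum_congr rfl hAs, sum_const, smul_eq_mul, hA]
  have h2 := ((hsum A s hA hs hAs).symm.trans (h.of_dvd hn)).trans (hsum A' s' hA' hs' hAs')
  exact hss ((Nat.ModEq.cancel_left_of_coprime hδ.symm h2).eq_of_lt_of_lt hs hs')

end Residues

/-! ### Maximal recoverability of the construction -/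

section Recoverability

variable {n m a δ : ℕ} {α : F} {c : Fin n → F}

theorem eq_zero_on_part (hα : IsPrimitiveRoot α n) (h0 : n ≠ 0)
    (hloc : ∀ t, 1 ≤ t → t < δ → ∀ S ∈ (residuePartition n m).parts,
      ∑ i ∈ S, c i * (α ^ (i : ℕ)) ^ t = 0)
    {S : Finset (Fin n)} (hS : S ∈ (residuePartition n m).parts)
    (hc : #{i ∈ S | c i ≠ 0} < δ) : ∀ i ∈ S, c i = 0 :=
  eq_zero_of_power_sums (s := 1) (d := δ - 1) (injective_pow_val hα).injOn
    (fun _ _ => pow_ne_zero _ (hα.ne_zero h0))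
    (fun t ht => hloc (1 + t) (by omega) (by omega) S hS) (by omega)

/-- Besides `δ - 1` coordinates of each residue class, the code recovers two more. If both lie in
one class, a Vandermonde system of size `δ + 1` does it. If they lie in different classes, the
local checks leave one degree of freedom in each, and the two global checks have determinant, up
to sign, the difference of the products of the nodes in the two classes. -/
theorem eq_zero_of_weight_le_two (hα : IsPrimitiveRoot α n) (hn : m ∣ n) (h0 : n ≠ 0)
    (hδ : 2 ≤ δ) (hcop : Nat.Coprime δ m)
    (hloc : ∀ t, 1 ≤ t → t < δ → ∀ S ∈ (residuePartition n m).parts,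
      ∑ i ∈ S, c i * (α ^ (i : ℕ)) ^ t = 0)
    (hsum : ∑ i : Fin n, c i = 0) (hsumδ : ∑ i : Fin n, c i * (α ^ (i : ℕ)) ^ δ = 0)
    {R : Finset (Fin n)} (hR : ∀ S ∈ (residuePartition n m).parts, #(S \ R) = δ - 1)
    (hc : #{i ∈ R | c i ≠ 0} ≤ 2) : c = 0 := by
  set P := residuePartition n m with hP
  set X : Finset (Fin n) := {i ∈ R | c i ≠ 0} with hX
  have hm : 0 < m := Nat.pos_of_dvd_of_pos hn (Nat.pos_of_ne_zero h0)
  have hα0 : ∀ i : Fin n, α ^ (i : ℕ) ≠ 0 := fun _ => pow_ne_zero _ (hα.ne_zero h0)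
  have hXmem : ∀ i, i ∈ R → i ∉ X → c i = 0 := fun i hiR hiX => by
    by_contra hne
    exact hiX (mem_filter.2 ⟨hiR, hne⟩)
  have hoff : ∀ S ∈ P.parts, (∀ i ∈ X, i ∉ S) → ∀ i ∈ S, c i = 0 := fun S hS hXS => by
    refine eq_zero_on_part hα h0 hloc hS (lt_of_le_of_lt (card_le_card
      (t := S \ R) fun i hi => ?_) (b := #(S \ R)) (by rw [hR S hS]; omega))
    obtain ⟨hiS, hne⟩ := mem_filter.1 hi
    exact mem_sdiff.2 ⟨hiS, fun hiR => hXS i (mem_filter.2 ⟨hiR, hne⟩) hiS⟩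
  by_cases hone : ∃ S ∈ P.parts, X ⊆ S
  · obtain ⟨S, hS, hXS⟩ := hone
    have hout : ∀ i, i ∉ S → c i = 0 := fun i hi => by
      obtain ⟨S', hS', hi'⟩ := P.exists_mem (mem_univ i)
      exact hoff S' hS' (fun j hj hj' => hi (P.eq_of_mem_parts hS' hS hj' (hXS hj) ▸ hi')) i hi'
    have hin : ∀ i ∈ S, c i = 0 := by
      refine eq_zero_of_power_sums (s := 0) (d := δ + 1) (injective_pow_val hα).injOn
        (fun i _ => hα0 i) (fun t ht => ?_) ?_
      · rcases Nat.eq_zero_or_pos t with rfl | htpos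
        · rw [← hsum]
          simp only [add_zero, pow_zero, mul_one]
          exact sum_subset (subset_univ _) fun i _ hi => hout i hi
        · rw [zero_add]
          rcases Nat.lt_succ_iff_lt_or_eq.1 ht with htδ | rfl
          · exact hloc t htpos htδ S hS
          · rw [← hsumδ]
            exact sum_subset (subset_univ _) fun i _ hi => by rw [hout i hi, zero_mul]
      · have : ({i ∈ S | c i ≠ 0} : Finset (Fin n)) ⊆ S \ R ∪ X := fun i hi => by
          obtain ⟨hiS, hne⟩ := mem_filter.1 hi
          by_cases hiR : i ∈ R
          · exact mem_union_right _ (mem_filter.2 ⟨hiR, hne⟩)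
          · exact mem_union_left _ (mem_sdiff.2 ⟨hiS, hiR⟩)
        have h1 := (card_le_card this).trans (card_union_le _ _)
        rw [hR S hS] at h1
        omega
    funext i
    by_cases hi : i ∈ S
    · exact hin i hi
    · exact hout i hi
  · exfalso
    push Not at hone
    have hpart : ∀ z, P.part z ∈ P.parts := fun z => P.part_mem.2 (mem_univ z)
    have hself : ∀ z, z ∈ P.part z := fun z => P.mem_part_self.2 (mem_univ z)
    obtain ⟨x, hxX, -⟩ := not_subset.1 (hone _ (hpart ⟨0, Nat.pos_of_ne_zero h0⟩))
    obtain ⟨y, hyX, hyS⟩ := not_subset.1 (hone _ (hpart x))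
    have hne : P.part x ≠ P.part y := fun h => hyS (h ▸ hself y)
    have hdisj : Disjoint (P.part x) (P.part y) := P.disjoint (hpart x) (hpart y) hne
    have hxy : x ≠ y := fun h => hne (h ▸ rfl)
    have hXeq : {x, y} = X := eq_of_subset_of_card_le
      (insert_subset_iff.2 ⟨hxX, singleton_subset_iff.2 hyX⟩) (by rw [card_pair hxy]; exact hc)
    let A : Fin n → Finset (Fin n) := fun z => insert z (P.part z \ R)
    have hAsub : ∀ z, A z ⊆ P.part z := fun z => insert_subset_iff.2 ⟨hself z, sdiff_subset⟩
    have hAcard : ∀ z ∈ X, #(A z) = δ := fun z hz => by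
      rw [card_insert_of_notMem (fun h => (mem_sdiff.1 h).2 (mem_filter.1 hz).1),
        hR _ (hpart z)]
      omega
    have hAout : ∀ z ∈ X, ∀ i ∈ P.part z, i ∉ A z → c i = 0 := by
      intro z hz i hi hiA
      simp only [A, mem_insert, mem_sdiff, not_or, not_and, not_not] at hiA
      refine hXmem i (hiA.2 hi) fun hiX => ?_
      rw [← hXeq, mem_insert, mem_singleton] at hz hiX
      rcases hz with rfl | rfl <;> rcases hiX with rfl | rfl
      · exact hiA.1 rfl
      · exact disjoint_left.1 hdisj hi (hself _)
      · exact disjoint_left.1 hdisj (hself _) hi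
      · exact hiA.1 rfl
    have hsupp : ∀ i, i ∉ A x ∪ A y → c i = 0 := by
      intro i hi
      rw [mem_union, not_or] at hi
      by_cases hix : i ∈ P.part x
      · exact hAout x hxX i hix hi.1
      by_cases hiy : i ∈ P.part y
      · exact hAout y hyX i hiy hi.2
      refine hoff _ (hpart i) (fun j hj hji => ?_) i (hself i)
      rw [← hXeq, mem_insert, mem_singleton] at hj
      rcases hj with rfl | rfl
      · exact hix (P.part_eq_of_mem (hpart i) hji ▸ hself i)
      · exact hiy (P.part_eq_of_mem (hpart i) hji ▸ hself i)
    have hlocA : ∀ z ∈ X, ∀ t, 1 ≤ t → t < #(A z) →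
        ∑ i ∈ A z, c i * (α ^ (i : ℕ)) ^ t = 0 := by
      intro z hz t ht ht'
      rw [← hloc t ht (hAcard z hz ▸ ht') _ (hpart z)]
      exact sum_subset (hAsub z) fun i hi hiA => by rw [hAout z hz i hi hiA, zero_mul]
    have hsplit : ∀ f : Fin n → F, ∑ i, c i * f i =
        ∑ i ∈ A x, c i * f i + ∑ i ∈ A y, c i * f i := fun f => by
      rw [← sum_union (hdisj.mono (hAsub x) (hAsub y))]
      exact (sum_subset (subset_univ _) fun i _ hi => by rw [hsupp i hi, zero_mul]).symm
    have hx := power_sum_card_add (by rw [hAcard x hxX]; omega) (hlocA x hxX)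
    have hy := power_sum_card_add (by rw [hAcard y hyX]; omega) (hlocA y hyX)
    rw [hAcard x hxX] at hx
    rw [hAcard y hyX] at hy
    have hV := hsplit fun _ => 1
    simp only [mul_one, hsum] at hV
    rw [hsplit] at hsumδ
    obtain ⟨s, hs, hsx⟩ := exists_residue_of_mem_parts hm (hpart x)
    obtain ⟨s', hs', hsy⟩ := exists_residue_of_mem_parts hm (hpart y)
    have hprod := prod_pow_ne_of_residue_ne hα h0 hn hcop hs hs'
      (by rintro rfl; exact hne (hsx.trans hsy.symm)) (hAcard x hxX) (hAcard y hyX)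
      (fun i hi => (mem_filter.1 ((congrArg (i ∈ ·) hsx).mp (hAsub x hi))).2)
      (fun i hi => (mem_filter.1 ((congrArg (i ∈ ·) hsy).mp (hAsub y hi))).2)
    have hmul : (-1) ^ δ * (∏ i ∈ A x, α ^ (i : ℕ) - ∏ i ∈ A y, α ^ (i : ℕ)) *
        ∑ i ∈ A x, c i = 0 := by
      linear_combination hx + hy - hsumδ +
        (-1) ^ δ * (∏ i ∈ A y, α ^ (i : ℕ)) * hV
    have hVx : ∑ i ∈ A x, c i = 0 := (mul_eq_zero.1 hmul).resolve_left
      (mul_ne_zero (pow_ne_zero _ (neg_ne_zero.2 one_ne_zero)) (sub_ne_zero.2 hprod))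
    refine (mem_filter.1 hxX).2 (eq_zero_of_power_sums (s := 0) (d := δ) (S := A x)
      (injective_pow_val hα).injOn (fun i _ => hα0 i) (fun t ht => ?_)
      ((card_filter_le _ _).trans (hAcard x hxX).le) x (mem_insert_self _ _))
    rw [zero_add]
    rcases Nat.eq_zero_or_pos t with rfl | htpos
    · simpa using hVx
    · exact hlocA x hxX t htpos (by rw [hAcard x hxX]; exact ht)

end Recoverability

section Setting

variable {q b r δ : ℕ} {α : F}

theorem ConstructionSetting.div_mul_self (h : ConstructionSetting q b r δ α) :
    (q ^ b - 1) / (r + δ - 1) * (r + δ - 1) = q ^ b - 1 :=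
  Nat.div_mul_cancel (h.dvd.trans (by simpa using Nat.sub_dvd_pow_sub_pow q 1 b))

theorem ConstructionSetting.two_mul_le (h : ConstructionSetting q b r δ α) :
    2 * (r + δ - 1) ≤ q ^ b - 1 := by
  have hq := h.prime_power.two_le
  have h1 : r + δ - 1 ≤ q - 1 := Nat.le_of_dvd (by omega) h.dvd
  have h2 : q ^ 2 ≤ q ^ b := Nat.pow_le_pow_right (by omega) h.two_le_b
  have h3 : 2 * q ≤ q ^ 2 := by nlinarith
  omega

theorem ConstructionSetting.two_le_div (h : ConstructionSetting q b r δ α) :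
    2 ≤ (q ^ b - 1) / (r + δ - 1) := by
  have := h.two_le_r
  have := h.two_le_delta
  exact (Nat.le_div_iff_mul_le (by omega)).2 h.two_mul_le

theorem ConstructionSetting.length_ne_zero (h : ConstructionSetting q b r δ α) :
    q ^ b - 1 ≠ 0 := by
  have := h.two_mul_le
  have := h.two_le_r
  have := h.two_le_delta
  omega

theorem ConstructionSetting.modEq_of_pow_eq (h : ConstructionSetting q b r δ α) {x y : ℕ}
    (hxy : α ^ x = α ^ y) : x ≡ y [MOD q ^ b - 1] := by
  rwa [(h.primitive.isOfFinOrder h.length_ne_zero).pow_eq_pow_iff_modEq,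
    ← h.primitive.eq_orderOf] at hxy

theorem ConstructionSetting.card_constructionRoots (h : ConstructionSetting q b r δ α) :
    #(constructionRoots q b r δ α) = (q ^ b - 1) / (r + δ - 1) * (δ - 1) + 2 := by
  have hr := h.two_le_r
  have hδ := h.two_le_delta
  have hmod : ∀ {x y : ℕ}, α ^ x = α ^ y → x ≡ y [MOD r + δ - 1] := fun hxy =>
    (h.modEq_of_pow_eq hxy).of_dvd ⟨_, (h.div_mul_self.symm.trans (mul_comm _ _))⟩
  have hmodt : ∀ j t : ℕ, t < r + δ - 1 → (j * (r + δ - 1) + t) % (r + δ - 1) = t :=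
    fun j t ht => by rw [Nat.mul_add_mod_self_right, Nat.mod_eq_of_lt ht]
  have hne : (1 : F) ≠ α ^ δ := fun heq => by
    have := hmod ((pow_zero α).trans heq)
    rw [Nat.ModEq, Nat.zero_mod, Nat.mod_eq_of_lt (by omega)] at this
    omega
  rw [constructionRoots, card_union_of_disjoint, card_pair hne, card_image_of_injOn,
    card_product, Nat.card_Icc, Nat.card_Icc]
  · simp
  · rintro ⟨j, t⟩ hp ⟨j', t'⟩ hp' heq
    simp only [coe_product, Set.mem_prod, mem_coe, mem_Icc] at hp hp'
    have ht := hmod heq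
    rw [Nat.ModEq, hmodt _ _ (by omega), hmodt _ _ (by omega)] at ht
    subst ht
    have hj := (h.modEq_of_pow_eq heq).add_right_cancel' t
    rw [← h.div_mul_self] at hj
    have hj := Nat.ModEq.mul_right_cancel' (by omega) hj
    -- The representatives `1, …, m` of the residues modulo `m` are shifted to `0, …, m - 1`.
    have hj : j - 1 ≡ j' - 1 [MOD (q ^ b - 1) / (r + δ - 1)] := by
      refine Nat.ModEq.add_right_cancel' 1 ?_
      rwa [Nat.sub_add_cancel hp.1.1, Nat.sub_add_cancel hp'.1.1]
    have := hj.eq_of_lt_of_lt (by omega) (by omega)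
    rw [Prod.mk.injEq]
    omega
  · rw [disjoint_left]
    rintro x hx hx'
    obtain ⟨⟨j, t⟩, hp, rfl⟩ := mem_image.1 hx
    simp only [mem_product, mem_Icc] at hp
    rw [mem_insert, mem_singleton] at hx'
    rcases hx' with hx' | hx'
    · have := hmod (hx'.trans (pow_zero α).symm)
      rw [Nat.ModEq, hmodt _ _ (by omega), Nat.zero_mod] at this
      omega
    · have := hmod hx'
      rw [Nat.ModEq, hmodt _ _ (by omega), Nat.mod_eq_of_lt (by omega)] at this
      omega

theorem ConstructionSetting.finrank_add_two (h : ConstructionSetting q b r δ α) :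
    Module.finrank F (constructedCode q b r δ α) + 2 = (q ^ b - 1) / (r + δ - 1) * r := by
  have hδ := h.two_le_delta
  have hr := h.two_le_r
  have hm := h.two_le_div
  have hcard := h.card_constructionRoots
  have hlen : (q ^ b - 1) / (r + δ - 1) * (δ - 1) + (q ^ b - 1) / (r + δ - 1) * r =
      q ^ b - 1 := by
    rw [← Nat.mul_add, show δ - 1 + r = r + δ - 1 by omega, h.div_mul_self]
  have hmr := Nat.mul_le_mul hm hr
  have := finrank_codeOfRoots_add_card (n := q ^ b - 1) (R := constructionRoots q b r δ α)
    (by omega)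
  rw [constructedCode]
  omega

theorem mem_constructedCode {c : Fin (q ^ b - 1) → F} :
    c ∈ constructedCode q b r δ α ↔
      (∀ j t, (1 ≤ j ∧ j ≤ (q ^ b - 1) / (r + δ - 1)) ∧ 1 ≤ t ∧ t ≤ δ - 1 →
        ∑ i, c i * (α ^ (j * (r + δ - 1) + t)) ^ (i : ℕ) = 0) ∧
      ∑ i, c i = 0 ∧ ∑ i, c i * (α ^ δ) ^ (i : ℕ) = 0 := by
  rw [constructedCode, mem_codeOfRoots, constructionRoots, forall_mem_union, forall_mem_image]
  simp [Prod.forall]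

variable {c : Fin (q ^ b - 1) → F}

theorem ConstructionSetting.sum_part_eq_zero (h : ConstructionSetting q b r δ α)
    (hc : c ∈ constructedCode q b r δ α) (t : ℕ) (ht : 1 ≤ t) (ht' : t < δ) :
    ∀ S ∈ (residuePartition (q ^ b - 1) ((q ^ b - 1) / (r + δ - 1))).parts,
      ∑ i ∈ S, c i * (α ^ (i : ℕ)) ^ t = 0 :=
  local_power_sum_eq_zero h.primitive h.div_mul_self (Nat.pos_of_ne_zero h.length_ne_zero)
    fun j hj hj' => (mem_constructedCode.1 hc).1 j t ⟨⟨hj, hj'⟩, ht, by omega⟩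

theorem sum_mul_pow_delta_eq_zero (hc : c ∈ constructedCode q b r δ α) :
    ∑ i : Fin (q ^ b - 1), c i * (α ^ (i : ℕ)) ^ δ = 0 := by
  rw [← (mem_constructedCode.1 hc).2.2]
  exact sum_congr rfl fun i _ => by rw [pow_right_comm]

theorem ConstructionSetting.isMRPartition (h : ConstructionSetting q b r δ α) :
    IsMRPartition (constructedCode q b r δ α)
      (residuePartition (q ^ b - 1) ((q ^ b - 1) / (r + δ - 1))) r 2 δ := by
  have hm := h.two_le_div
  have hδ := h.two_le_delta
  have hcard := card_of_mem_parts h.div_mul_self (by omega)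
  refine ⟨⟨hcard, fun S hS c hc hlt => ?_⟩, ?_, fun R hR c hc hle => ?_⟩
  · exact eq_zero_on_part h.primitive h.length_ne_zero (h.sum_part_eq_zero hc) hS hlt
  · exact h.finrank_add_two.trans (congrArg (· * r) (div_eq_card_parts (by omega) hcard))
  · exact eq_zero_of_weight_le_two h.primitive ⟨_, h.div_mul_self.symm⟩ h.length_ne_zero hδ
      h.coprime (h.sum_part_eq_zero hc) (mem_constructedCode.1 hc).2.1
      (sum_mul_pow_delta_eq_zero hc) hR hle

theorem ConstructionSetting.finrank_pos (h : ConstructionSetting q b r δ α) :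
    0 < Module.finrank F (constructedCode q b r δ α) := by
  have := h.finrank_add_two
  have := Nat.mul_le_mul h.two_le_div h.two_le_r
  omega

theorem ConstructionSetting.isMRCode (h : ConstructionSetting q b r δ α) :
    IsMRCode (constructedCode q b r δ α) r 2 δ := by
  have := h.two_le_delta
  exact isMRCode_of_isMRPartition (by omega) (by omega) h.isMRPartition h.finrank_pos

theorem ConstructionSetting.isCyclicCode (h : ConstructionSetting q b r δ α) :
    IsCyclicCode (constructedCode q b r δ α) := by
  refine isCyclicCode_codeOfRoots fun ρ hρ => ?_
  have hpow : ∀ e, (α ^ e) ^ (q ^ b - 1) = 1 := fun e => by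
    rw [pow_right_comm, h.primitive.pow_eq_one, one_pow]
  rw [constructionRoots, mem_union, mem_image, mem_insert, mem_singleton] at hρ
  rcases hρ with ⟨p, -, rfl⟩ | rfl | rfl
  · exact hpow _
  · exact one_pow _
  · exact hpow _

/-! ### Optimality -/

/-- The BCH bound for the consecutive roots `1, α, …, α ^ δ`. -/
theorem ConstructionSetting.minDistAtLeast (h : ConstructionSetting q b r δ α) :
    MinDistAtLeast (constructedCode q b r δ α) (δ + 2) := by
  intro c hc hne
  by_contra hlt
  refine hne (funext fun i => eq_zero_of_power_sums (S := univ) (s := 0) (d := δ + 1)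
    (injective_pow_val h.primitive).injOn
    (fun _ _ => pow_ne_zero _ (h.primitive.ne_zero h.length_ne_zero)) (fun t ht => ?_)
    (Nat.lt_succ_iff.1 (not_le.1 hlt)) i (mem_univ i))
  rw [zero_add]
  rcases Nat.eq_zero_or_pos t with rfl | htpos
  · simpa using (mem_constructedCode.1 hc).2.1
  rcases Nat.lt_succ_iff_lt_or_eq.1 ht with htδ | rfl
  · have hm := h.two_le_div
    have := (mem_constructedCode.1 hc).1 _ t ⟨⟨by omega, le_rfl⟩, htpos, by omega⟩
    rw [← this, h.div_mul_self, pow_add, h.primitive.pow_eq_one, one_mul]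
    exact sum_congr rfl fun i _ => by rw [pow_right_comm]
  · exact sum_mul_pow_delta_eq_zero hc

/-- An MR code with `h = 2` and `r > 2` has a nonzero word of weight at most `δ + 2`, supported
on a single repair set. -/
theorem IsMRPartition.exists_hammingNorm_le {n : ℕ} {D : Submodule F (Fin n → F)}
    {P : Finpartition (univ : Finset (Fin n))} (hP : IsMRPartition D P r 2 δ) (hδ : 1 ≤ δ)
    (hr : 2 < r) {S : Finset (Fin n)} (hS : S ∈ P.parts) :
    ∃ c ∈ D, c ≠ 0 ∧ hammingNorm c ≤ δ + 2 := by
  obtain ⟨R, hR⟩ := hP.exists_transversal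
  have hcard := card_transversal hδ hP.card_eq hR
  have hRS := card_inter_of_card_sdiff hδ (hP.card_eq S hS) (hR S hS)
  have hrank := hP.finrank_add
  -- All of `R` but three coordinates of `S` is set to zero.
  obtain ⟨X, hXS, hX⟩ := exists_subset_card_eq (s := S ∩ R) (n := 3) (by omega)
  have hZ := card_sdiff_of_subset (hXS.trans inter_subset_right)
  have hle := card_le_card (inter_subset_right : S ∩ R ⊆ R)
  obtain ⟨c, hc, hne, h0⟩ := exists_ne_zero_of_card_lt_finrank (C := D) (Z := R \ X) (by omega)
  refine ⟨c, hc, hne, ?_⟩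
  have hsub : ({i | c i ≠ 0} : Finset (Fin n)) ⊆ S \ R ∪ X := by
    intro i hi
    by_contra hiX
    rw [mem_union, mem_sdiff, not_or, not_and, not_not] at hiX
    refine (mem_filter.1 hi).2 ?_
    by_cases hiS : i ∈ S
    · exact h0 i (mem_sdiff.2 ⟨hiX.1 hiS, hiX.2⟩)
    · obtain ⟨S', hS', hi'⟩ := P.exists_mem (mem_univ i)
      refine hP.eq_zero_of_sdiff hδ hS' (hR S' hS') hc (fun j hj => ?_) i hi'
      obtain ⟨hjS', hjR⟩ := mem_inter.1 hj
      refine h0 j (mem_sdiff.2 ⟨hjR, fun hjX => hiS ?_⟩)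
      exact P.eq_of_mem_parts hS' hS hjS' (mem_inter.1 (hXS hjX)).1 ▸ hi'
  have := (card_le_card hsub).trans (card_union_le _ _)
  rw [hR S hS, hX] at this
  exact this.trans (by omega)

theorem ConstructionSetting.isOptimalLRC (h : ConstructionSetting q b r δ α) (hr : 2 < r) :
    IsOptimalLRC (constructedCode q b r δ α) r δ := by
  have hδ := h.two_le_delta
  have hn0 := h.length_ne_zero
  obtain ⟨⟨P, hP, -⟩, -⟩ := h.isMRCode
  refine ⟨fun j => ?_, δ + 2, ⟨h.minDistAtLeast, ?_⟩, ?_⟩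
  · obtain ⟨S, hS, hj⟩ := P.exists_mem (mem_univ j)
    exact ⟨S, (hP S hS).2 j hj⟩
  · obtain ⟨S, hS, -⟩ := (residuePartition (q ^ b - 1) ((q ^ b - 1) / (r + δ - 1))).exists_mem
      (mem_univ (⟨0, Nat.pos_of_ne_zero hn0⟩ : Fin (q ^ b - 1)))
    obtain ⟨c, hc, hne, hle⟩ := h.isMRPartition.exists_hammingNorm_le (by omega) hr hS
    exact ⟨c, hc, hne, le_antisymm hle (h.minDistAtLeast c hc hne)⟩
  · have hk := h.finrank_add_two
    have hn := h.div_mul_self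
    rw [Fintype.card_fin]
    generalize (q ^ b - 1) / (r + δ - 1) = m at hk hn
    generalize Module.finrank F (constructedCode q b r δ α) = k at hk ⊢
    have hkQ : (k : ℚ) + 2 = m * r := by exact_mod_cast hk
    have hrQ : (2 : ℚ) < r := by exact_mod_cast hr
    have hceil : ⌈(k : ℚ) / (r : ℚ)⌉ = (m : ℤ) := by
      rw [Int.ceil_eq_iff, lt_div_iff₀ (by linarith), div_le_iff₀ (by linarith)]
      push_cast
      constructor <;> nlinarith
    have hkZ : (k : ℤ) + 2 = m * r := by exact_mod_cast hk
    have hnZ : ((q ^ b - 1 : ℕ) : ℤ) = m * (r + δ - 1) := by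
      rw [← hn, Nat.cast_mul, Nat.cast_sub (by omega)]
      push_cast
      ring
    rw [hceil, hnZ]
    push_cast
    linear_combination hkZ

/-- For `r = 2` the length of an MR code with `h = 2` is at most the number of points of the
projective line over its field. -/
theorem IsMRPartition.length_le_card_add_one {K : Type*} [Field K] [Finite K] {n : ℕ}
    {D : Submodule K (Fin n → K)} {P : Finpartition (univ : Finset (Fin n))}
    (hP : IsMRPartition D P 2 2 δ) (hδ : 2 ≤ δ) (hm : 2 ≤ #P.parts) :
    n ≤ Nat.card K + 1 := by
  have hbound := hP.length_mul_le hδ hm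
  have hQ : 2 ≤ Nat.card K := Finite.one_lt_card
  have hlen : 5 ≤ n := by
    have h1 := card_parts_mul hP.card_eq
    have : 2 * 3 ≤ #P.parts * (2 + δ - 1) := Nat.mul_le_mul hm (by omega)
    omega
  by_contra! hlt
  obtain ⟨Q, hQ'⟩ := Nat.exists_eq_add_of_le' (show 1 ≤ Nat.card K by omega)
  rw [hQ', Nat.add_sub_cancel] at hbound
  rw [hQ'] at hlt hQ
  -- The bound on the number of cosets excludes lengths above `|K| + 1`, except when `|K| = 2`.
  rcases Nat.lt_or_ge Q 2 with hQ2 | hQ2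
  · have : Q = 1 := by omega
    subst this
    omega
  · nlinarith

theorem ConstructionSetting.hasOptimalFieldSize {F : Type*} [Field F] {α : F}
    (h : ConstructionSetting q b 2 δ α) (h1 : ¬ IsPrimePow (q ^ b - 1))
    (h2 : ¬ IsPrimePow (q ^ b - 2)) :
    HasOptimalFieldSize (constructedCode q b 2 δ α) 2 2 δ := by
  have hδ := h.two_le_delta
  refine ⟨h.isMRCode, fun K _ _ D hD => ?_⟩
  obtain ⟨P, hP⟩ := hD.exists_isMRPartition (by omega) (by omega)
  have hm := h.two_le_div
  rw [div_eq_card_parts (by omega) hP.card_eq] at hm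
  have hle := hP.length_le_card_add_one hδ hm
  have hpp : IsPrimePow (Nat.card K) := by
    have := Fintype.ofFinite K
    rw [Nat.card_eq_fintype_card]
    exact FiniteField.isPrimePow_card K
  have hne1 : Nat.card K ≠ q ^ b - 1 := fun heq => h1 (heq ▸ hpp)
  have hne2 : Nat.card K ≠ q ^ b - 2 := fun heq => h2 (heq ▸ hpp)
  rw [h.card_field]
  omega

theorem fieldSizeBound_two (n r : ℕ) : fieldSizeBound n r 2 δ = n := by
  simp [fieldSizeBound]

/-- The field size bound with its constant: a transversal of an MR code with `h = 2` has at most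
`2 |K|` coordinates, and it makes up at least a fraction `1 / δ` of all of them. -/
theorem IsMRCode.length_le {K : Type*} [Field K] [Finite K] {n : ℕ}
    {D : Submodule K (Fin n → K)} (hD : IsMRCode D r 2 δ) (hr : 1 ≤ r) (hδ : 1 ≤ δ) :
    n ≤ 2 * δ * Nat.card K := by
  obtain ⟨P, hP⟩ := hD.exists_isMRPartition hδ (by omega)
  have hbound := hP.card_parts_mul_le hδ
  have hQ : 2 ≤ Nat.card K := Finite.one_lt_card
  have hmr : #P.parts * r ≤ 2 * Nat.card K := by
    refine Nat.le_of_mul_le_mul_right (c := Nat.card K - 1) (hbound.trans ?_) (by omega)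
    obtain ⟨Q, hQ'⟩ := Nat.exists_eq_add_of_le' hQ
    rw [hQ', show Q + 2 - 1 = Q + 1 by omega]
    nlinarith
  have ha : r + δ - 1 ≤ r * δ := by
    obtain ⟨r, rfl⟩ := Nat.exists_eq_add_of_le' hr
    obtain ⟨δ, rfl⟩ := Nat.exists_eq_add_of_le' hδ
    have : (r + 1) * (δ + 1) = r * δ + (r + 1 + (δ + 1) - 1) := by
      rw [show r + 1 + (δ + 1) - 1 = r + δ + 1 by omega]
      ring
    omega
  calc n = #P.parts * (r + δ - 1) := (card_parts_mul hP.card_eq).symm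
    _ ≤ #P.parts * (r * δ) := Nat.mul_le_mul_left _ ha
    _ = #P.parts * r * δ := (mul_assoc _ _ _).symm
    _ ≤ 2 * Nat.card K * δ := Nat.mul_le_mul_right _ hmr
    _ = 2 * δ * Nat.card K := by ring

end Setting

end Construction

/-- Each code of the construction is a cyclic `(q ^ b - 1, r, 2, δ, q ^ b)`-MR code. For `r = 2`
its field size is optimal if neither `q ^ b - 1` nor `q ^ b - 2` is a prime power. For `r > 2` its
minimum distance is optimal, and its field size is order-optimal: for each constant `δ`, the bound
`Ω(n r ^ min {δ - 1, h - 2})` with `h = 2` holds for all MR codes with at least two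
repair sets, and the codes of the construction attain it up to a constant. -/
theorem mainTheorem6 :
    (∀ (F : Type*) [Field F] (q b r δ : ℕ) (α : F), ConstructionSetting q b r δ α →
      IsCyclicCode (constructedCode q b r δ α) ∧
      IsMRCode (constructedCode q b r δ α) r 2 δ ∧
      (r = 2 → ¬ IsPrimePow (q ^ b - 1) → ¬ IsPrimePow (q ^ b - 2) →
        HasOptimalFieldSize (constructedCode q b r δ α) r 2 δ) ∧
      (2 < r → IsOptimalLRC (constructedCode q b r δ α) r δ)) ∧
    (∀ δ : ℕ, 2 ≤ δ → ∃ c₁ c₂ : ℝ, 0 < c₁ ∧ 0 < c₂ ∧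
      (∀ (K : Type*) [Field K] [Finite K] (n r : ℕ) (D : Submodule K (Fin n → K)),
        1 ≤ r → 2 ≤ n / (r + δ - 1) → IsMRCode D r 2 δ →
          c₁ * fieldSizeBound n r 2 δ ≤ (Nat.card K : ℝ)) ∧
      (∀ (F : Type*) [Field F] (q b r : ℕ) (α : F), ConstructionSetting q b r δ α → 2 < r →
        (Nat.card F : ℝ) ≤ c₂ * fieldSizeBound (q ^ b - 1) r 2 δ)) := by
  -- `1 / (2 δ)` comes from the coset count, `2` from `q ^ b ≤ 2 (q ^ b - 1)`.
  refine ⟨fun F _ q b r δ α h => ⟨h.isCyclicCode, h.isMRCode, ?_, h.isOptimalLRC⟩,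
    fun δ hδ => ⟨1 / (2 * δ), 2, by positivity, two_pos, ?_, ?_⟩⟩
  · rintro rfl h1 h2
    exact h.hasOptimalFieldSize h1 h2
  · intro K _ _ n r D hr _ hD
    rw [fieldSizeBound_two, one_div, inv_mul_le_iff₀ (by positivity)]
    exact_mod_cast hD.length_le hr (by omega)
  · intro F _ q b r α h _
    have hn := h.length_ne_zero
    rw [fieldSizeBound_two, h.card_field]
    have : q ^ b ≤ 2 * (q ^ b - 1) := by omega
    exact_mod_cast this
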